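/- Let $(\Omega,\mathcal F,\mu)$ be a probability space and $T:\Omega\to\Omega$ an invertible, bi-measurable, $\mu$-preserving, ergodic transformation. Let $c:\Omega\to(0,+\infty)$ be measurable. In the environment $\omega\in\Omega$ the edge $\{x,x+1\}$ of $\mathbb Z$ carries the conductance $c(x,x+1)(\omega)=c(T^x\omega)$. Put $\bar c(x)(\omega)=c(x-1,x)(\omega)+c(x,x+1)(\omega)$ and $\bar c=\bar c(0)$. Let $(S_n)_{n\ge 0}$ be the nearest-neighbour Markov chain on $\mathbb Z$ with transition probabilities $p(x,x\pm1)=c(x,x\pm1)/\bar c(x)$ (where $c(x,x-1)=c(x-1,x)$), let $\mathbb P_0^\omega$ be its law when started at $0$, and let $P$ be its transition operator, $Pf(x)=p(x,x-1)f(x-1)+p(x,x+1)f(x+1)$. For finitely supported $f:\mathbb Z\to\mathbb R$ put $\|f\|^2=\sum_{x\in\mathbb Z}f(x)^2\,\bar c(x)$, and let $h_n=P^n\bigl(\bar c(0)^{-1}\mathbf 1_{\{0\}}\bigr)$ be the heat kernel based at $0$. Assume that $1/c$ is $\mu$-integrable. Then for every $\omega$ and every $n\ge0$, $$\|h_n\|^2=\frac{\mathbb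 P_0^\omega[S_{2n}=0]}{\bar c(0)(\omega)},$$ and for $\mu$-almost every $\omega$, $$\limsup_{n\to+\infty}\sqrt n\,\|h_n\|^2\;\le\;3\,\sqrt{\frac{\int \frac1c\,d\mu}{\int\bar c\,d\mu}},$$ where the right-hand side is $0$ when $\int\bar c\,d\mu=+\infty$. In particular, if $\int\bar c\,d\mu=+\infty$, then for $\mu$-almost every $\omega$, $\lim_{n\to+\infty}\sqrt n\,\|h_n\|^2=0$. -/

import Mathlib

open MeasureTheory ProbabilityTheory Filter
open scoped ENNReal

noncomputable section

/-- A family of strictly positive conductances on the edges of `ℤ`; `C.cond x` is the conductance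
`c(x, x+1)` of the unoriented edge `{x, x+1}`. -/
structure Conductances where
  cond : ℤ → ℝ
  pos : ∀ x, 0 < cond x

namespace Conductances

/-- `c̄(x) = c(x-1, x) + c(x, x+1)`, the reversible measure of the walk. -/
def cbar (C : Conductances) (x : ℤ) : ℝ := C.cond (x - 1) + C.cond x

/-- The transition probability `p(x, x+1) = c(x, x+1) / c̄(x)`. -/
def pRight (C : Conductances) (x : ℤ) : ℝ := C.cond x / C.cbar x

/-- The transition probability `p(x, x-1) = c(x-1, x) / c̄(x)`. -/
def pLeft (C : Conductances) (x : ℤ) : ℝ := C.cond (x - 1) / C.cbar x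

lemma cbar_pos (C : Conductances) (x : ℤ) : 0 < C.cbar x :=
  add_pos (C.pos _) (C.pos _)

lemma pLeft_nonneg (C : Conductances) (x : ℤ) : 0 ≤ C.pLeft x :=
  div_nonneg (C.pos _).le (C.cbar_pos x).le

lemma pRight_nonneg (C : Conductances) (x : ℤ) : 0 ≤ C.pRight x :=
  div_nonneg (C.pos _).le (C.cbar_pos x).le

lemma pLeft_add_pRight (C : Conductances) (x : ℤ) : C.pLeft x + C.pRight x = 1 := by
  rw [pLeft, pRight, ← add_div]
  exact div_self (C.cbar_pos x).ne'

/-- The transition kernel of the nearest neighbour walk: from `x` it jumps to `x - 1` with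
probability `p(x, x-1)` and to `x + 1` with probability `p(x, x+1)`. -/
def stepKernel (C : Conductances) : Kernel ℤ ℤ :=
  Kernel.ofFunOfCountable fun x =>
    ENNReal.ofReal (C.pLeft x) • Measure.dirac (x - 1) +
      ENNReal.ofReal (C.pRight x) • Measure.dirac (x + 1)

instance instIsMarkovKernelStepKernel (C : Conductances) : IsMarkovKernel C.stepKernel where
  isProbabilityMeasure x := by
    constructor
    change (ENNReal.ofReal (C.pLeft x) • Measure.dirac (x - 1) +
      ENNReal.ofReal (C.pRight x) • Measure.dirac (x + 1)) Set.univ = 1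
    simp [← ENNReal.ofReal_add (C.pLeft_nonneg x) (C.pRight_nonneg x), pLeft_add_pRight]

/-- The same transition kernel, as a function of the whole past `(S_0, …, S_n)`. -/
def stepFromPast (C : Conductances) (n : ℕ) : Kernel (Π _ : Finset.Iic n, ℤ) ℤ :=
  C.stepKernel.comap (fun h => h ⟨n, Finset.mem_Iic.2 le_rfl⟩) (measurable_pi_apply _)

instance instIsMarkovKernelStepFromPast (C : Conductances) (n : ℕ) :
    IsMarkovKernel (C.stepFromPast n) := by
  unfold stepFromPast
  infer_instance

/-- `ℙ_{x₀}`: the law, on the space of trajectories `ℕ → ℤ`, of the Markov chain `(S_n)` with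
transition kernel `stepKernel` and `S_0 = x₀`; here `S_n` is the `n`-th coordinate. -/
def pathLaw (C : Conductances) (x₀ : ℤ) : Measure (ℕ → ℤ) :=
  Kernel.traj (X := fun _ => ℤ) C.stepFromPast 0 (fun _ => x₀)

/-- The transition operator `P f(x) = p(x, x-1) f(x-1) + p(x, x+1) f(x+1)`. -/
def transitionOp (C : Conductances) (f : ℤ → ℝ) (x : ℤ) : ℝ :=
  f (x - 1) * C.pLeft x + f (x + 1) * C.pRight x

/-- The heat kernel based at `0`: `h_n = P^n (𝟙_{0} / c̄(0))`. -/
def heatKernel (C : Conductances) (n : ℕ) : ℤ → ℝ :=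
  C.transitionOp^[n] (Pi.single 0 (1 / C.cbar 0))

/-- `‖f‖² = ∑ₓ f(x)² c̄(x)`, for finitely supported `f`. -/
def normSq (C : Conductances) (f : ℤ → ℝ) : ℝ := ∑' x, f x ^ 2 * C.cbar x

/-- The heat kernel has finite support, so that the sum defining `‖h_n‖²` is a finite one. -/
lemma heatKernel_eq_zero (C : Conductances) (n : ℕ) (x : ℤ) (hx : (n : ℤ) < |x|) :
    C.heatKernel n x = 0 := by
  induction n generalizing x with
  | zero =>
    have h : x ≠ 0 := by rintro rfl; simp at hx
    simp [heatKernel, h]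
  | succ n ih =>
    push_cast at hx
    have e : C.heatKernel (n + 1) = C.transitionOp (C.heatKernel n) :=
      Function.iterate_succ_apply' _ _ _
    rw [e, transitionOp, ih (x - 1) (by grind), ih (x + 1) (by grind)]
    simp

end Conductances

/-- The conductances `c(x, x+1)(ω) = c(T^x ω)` in the environment `ω`. -/
def environment {Ω : Type*} [MeasurableSpace Ω] (T : Ω ≃ᵐ Ω) (c : Ω → ℝ) (hpos : ∀ ω, 0 < c ω)
    (ω : Ω) : Conductances where
  cond x := c (((T.toEquiv : Equiv.Perm Ω) ^ x) ω)
  pos _ := hpos _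

end

/-!
Write `h_n` for the heat kernel, `⟨f, g⟩ = ∑ₓ f(x) g(x) c̄(x)` and `u_n = ‖h_n‖²`. Since `P` is
self-adjoint for this form, `⟨h_j, h_k⟩ = h_{j+k}(0)`. In particular `u_n = h_{2n}(0)`, and this is
`ℙ₀[S_{2n} = 0] / c̄(0)` because `h_n` is the density of `S_n` with respect to `c̄`
(`Conductances.normSq_heatKernel_eq_pathLaw_div`).

The decay of `u_n` comes from a Nash-type argument on each environment
(`Conductances.normSq_heatKernel_le`), applied to `f = h_{2n} + h_{2n+1}`. The walk being
2-periodic, `f(0) = u_n`; the mass of `f` is `2`; and its Dirichlet energy is `u_{2n} - u_{2n+1}`.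
The decrements of `u` are nonincreasing, their differences being the squared norms
`‖h_k - h_{k+2}‖²`, so that this energy is at most `u_n / n`. Take an interval of `m` points at
either side of the origin, each of `c̄`-mass at least `W` and of resistance `∑ 1/c` at most `R`.
There are points `x`, `y` in the two intervals with `f(x) + f(y) ≤ 2 / W`, while Cauchy-Schwarz
along the paths to `x` and `y` gives `(f(0) - f(x))² + (f(0) - f(y))² ≤ R u_n / n`. Together,
`u_n ≤ 2 / W + R / (2n)`.

By ergodicity, almost surely `W ≥ m b'` and `R ≤ m r'` for all large `m`, whenever `b' < ∫ c̄ dμ`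
and `r' > ∫ 1/c dμ`. Only these one-sided estimates are needed, and they follow from
`Ergodic.ae_exists_le_birkhoffSum`: Birkhoff sums of a function of positive integral are almost
surely bounded below. With `m ∼ 2 √n / √(r' b')` one gets `limsup √n u_n ≤ 2 √(r' / b')`. The
constant `3` leaves room for taking `r' = (3/2) ∫ 1/c dμ` and `b' = (2/3) ∫ c̄ dμ`, and if
`∫ c̄ dμ = ∞` then `b'` is arbitrary.
-/

/-! ### The weighted inner product and the Dirichlet form -/

namespace Conductances

/-- The bilinear form `⟨f, g⟩ = ∑ₓ f(x) g(x) c̄(x)`. It is meaningful as soon as one of the two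
functions has finite support; the other one may be arbitrary. -/
noncomputable def innerProd (C : Conductances) (f g : ℤ → ℝ) : ℝ := ∑' x, f x * g x * C.cbar x

lemma summable_shift_mul_shift {f g : ℤ → ℝ} (h : f.support.Finite ∨ g.support.Finite)
    (j k : ℤ) (w : ℤ → ℝ) : Summable fun x => f (x + j) * g (x + k) * w x := by
  refine summable_of_hasFiniteSupport ?_
  rcases h with h | h
  · refine (h.preimage (add_left_injective j).injOn).subset fun x hx => ?_
    simp only [Function.mem_support, Set.mem_preimage] at hx ⊢
    exact fun h0 => hx (by rw [h0]; ring)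
  · refine (h.preimage (add_left_injective k).injOn).subset fun x hx => ?_
    simp only [Function.mem_support, Set.mem_preimage] at hx ⊢
    exact fun h0 => hx (by rw [h0]; ring)

lemma summable_mul_mul {f g : ℤ → ℝ} (h : f.support.Finite ∨ g.support.Finite)
    (w : ℤ → ℝ) : Summable fun x => f x * g x * w x := by
  simpa using summable_shift_mul_shift h 0 0 w

lemma innerProd_comm (C : Conductances) (f g : ℤ → ℝ) : C.innerProd f g = C.innerProd g f := by
  simp only [innerProd, mul_comm (f _)]

lemma innerProd_add_right (C : Conductances) {f g k : ℤ → ℝ}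
    (hg : f.support.Finite ∨ g.support.Finite) (hk : f.support.Finite ∨ k.support.Finite) :
    C.innerProd f (g + k) = C.innerProd f g + C.innerProd f k := by
  rw [innerProd, innerProd, innerProd,
    ← (summable_mul_mul hg C.cbar).tsum_add (summable_mul_mul hk C.cbar)]
  exact tsum_congr fun x => by simp only [Pi.add_apply]; ring

lemma innerProd_sub_right (C : Conductances) {f g k : ℤ → ℝ}
    (hg : f.support.Finite ∨ g.support.Finite) (hk : f.support.Finite ∨ k.support.Finite) :
    C.innerProd f (g - k) = C.innerProd f g - C.innerProd f k := by
  rw [innerProd, innerProd, innerProd,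
    ← (summable_mul_mul hg C.cbar).tsum_sub (summable_mul_mul hk C.cbar)]
  exact tsum_congr fun x => by simp only [Pi.sub_apply]; ring

lemma normSq_eq_innerProd (C : Conductances) (f : ℤ → ℝ) : C.normSq f = C.innerProd f f := by
  simp only [normSq, innerProd, sq]

lemma normSq_nonneg (C : Conductances) (f : ℤ → ℝ) : 0 ≤ C.normSq f :=
  tsum_nonneg fun x => mul_nonneg (sq_nonneg _) (C.cbar_pos x).le

lemma pLeft_mul_cbar (C : Conductances) (x : ℤ) : C.pLeft x * C.cbar x = C.cond (x - 1) :=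
  div_mul_cancel₀ _ (C.cbar_pos x).ne'

lemma pRight_mul_cbar (C : Conductances) (x : ℤ) : C.pRight x * C.cbar x = C.cond x :=
  div_mul_cancel₀ _ (C.cbar_pos x).ne'

lemma transitionOp_mul_cbar (C : Conductances) (f : ℤ → ℝ) (x : ℤ) :
    C.transitionOp f x * C.cbar x = f (x - 1) * C.cond (x - 1) + f (x + 1) * C.cond x := by
  rw [transitionOp, add_mul, mul_assoc, mul_assoc, pLeft_mul_cbar, pRight_mul_cbar]

lemma transitionOp_add (C : Conductances) (f g : ℤ → ℝ) :
    C.transitionOp (f + g) = C.transitionOp f + C.transitionOp g := by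
  ext x
  simp only [transitionOp, Pi.add_apply]
  ring

/-- Summing by edges rather than by vertices: the form `⟨f, P g⟩` is visibly symmetric. -/
lemma innerProd_transitionOp (C : Conductances) {f g : ℤ → ℝ}
    (h : f.support.Finite ∨ g.support.Finite) :
    C.innerProd f (C.transitionOp g) =
      ∑' x, (f (x + 1) * g x + f x * g (x + 1)) * C.cond x := by
  have h1 : Summable fun x => f (x + 1) * g x * C.cond x := by
    simpa using summable_shift_mul_shift h 1 0 C.cond
  have h2 : Summable fun x => f x * g (x + 1) * C.cond x := by
    simpa using summable_shift_mul_shift h 0 1 C.cond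
  have h3 : Summable fun x => f x * g (x - 1) * C.cond (x - 1) := by
    simpa [sub_eq_add_neg] using summable_shift_mul_shift h 0 (-1) fun x => C.cond (x - 1)
  have e : ∑' x, f x * g (x - 1) * C.cond (x - 1) = ∑' x, f (x + 1) * g x * C.cond x := by
    rw [← (Equiv.addRight (1 : ℤ)).tsum_eq fun x => f x * g (x - 1) * C.cond (x - 1)]
    simp
  calc C.innerProd f (C.transitionOp g)
      = ∑' x, (f x * g (x - 1) * C.cond (x - 1) + f x * g (x + 1) * C.cond x) :=
        tsum_congr fun x => by rw [mul_assoc, transitionOp_mul_cbar]; ring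
    _ = ∑' x, (f (x + 1) * g x * C.cond x + f x * g (x + 1) * C.cond x) := by
        rw [h3.tsum_add h2, h1.tsum_add h2, e]
    _ = _ := tsum_congr fun x => by ring

/-- Reversibility of the walk. -/
lemma innerProd_transitionOp_comm (C : Conductances) {f g : ℤ → ℝ}
    (h : f.support.Finite ∨ g.support.Finite) :
    C.innerProd f (C.transitionOp g) = C.innerProd (C.transitionOp f) g := by
  rw [C.innerProd_comm _ g, C.innerProd_transitionOp h, C.innerProd_transitionOp h.symm]
  exact tsum_congr fun x => by ring

lemma tsum_cond_mul_sq (C : Conductances) {f : ℤ → ℝ} (hf : f.support.Finite) :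
    ∑' x, C.cond x * (f (x + 1) - f x) ^ 2 =
      C.innerProd f f - C.innerProd f (C.transitionOp f) := by
  have h1 : Summable fun x => f (x + 1) * f (x + 1) * C.cond x :=
    summable_shift_mul_shift (.inl hf) 1 1 C.cond
  have h2 : Summable fun x => f x * f x * C.cond x := summable_mul_mul (.inl hf) C.cond
  have h3 : Summable fun x => (f (x + 1) * f x + f x * f (x + 1)) * C.cond x := by
    have ha := summable_shift_mul_shift (.inl hf : _ ∨ f.support.Finite) 1 0 C.cond
    have hb := summable_shift_mul_shift (.inl hf : _ ∨ f.support.Finite) 0 1 C.cond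
    simpa [add_mul] using ha.add hb
  have e : C.innerProd f f =
      ∑' x, f (x + 1) * f (x + 1) * C.cond x + ∑' x, f x * f x * C.cond x := by
    rw [← (Equiv.subRight (1 : ℤ)).tsum_eq fun x => f (x + 1) * f (x + 1) * C.cond x]
    simp only [Equiv.subRight_apply, sub_add_cancel]
    rw [← (summable_mul_mul (.inl hf) fun x => C.cond (x - 1)).tsum_add h2]
    exact tsum_congr fun x => by rw [cbar]; ring
  rw [C.innerProd_transitionOp (.inl hf), e, ← h1.tsum_add h2, ← (h1.add h2).tsum_sub h3]
  exact tsum_congr fun x => by ring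

lemma summable_cond_mul_sq (C : Conductances) {f : ℤ → ℝ} (hf : f.support.Finite) :
    Summable fun x => C.cond x * (f (x + 1) - f x) ^ 2 := by
  have h1 := summable_shift_mul_shift (.inl hf : _ ∨ f.support.Finite) 1 1 C.cond
  have h2 := summable_shift_mul_shift (.inl hf : _ ∨ f.support.Finite) 0 0 C.cond
  have h3 := summable_shift_mul_shift (.inl hf : _ ∨ f.support.Finite) 1 0 C.cond
  refine ((h1.add h2).sub (h3.mul_left 2)).congr fun x => ?_
  simp only [add_zero]
  ring

/-! ### The heat kernel -/

lemma heatKernel_succ (C : Conductances) (n : ℕ) :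
    C.heatKernel (n + 1) = C.transitionOp (C.heatKernel n) :=
  Function.iterate_succ_apply' _ _ _

lemma finite_support_heatKernel (C : Conductances) (n : ℕ) :
    (C.heatKernel n).support.Finite := by
  refine (Set.finite_Icc (-(n : ℤ)) n).subset fun x hx => ?_
  rw [Set.mem_Icc, ← abs_le]
  by_contra h
  exact hx (C.heatKernel_eq_zero n x (not_le.1 h))

lemma heatKernel_nonneg (C : Conductances) (n : ℕ) (x : ℤ) : 0 ≤ C.heatKernel n x := by
  induction n generalizing x with
  | zero =>
    have : 0 ≤ 1 / C.cbar 0 := (one_div_pos.2 (C.cbar_pos 0)).le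
    by_cases h : x = 0
    · subst h; simpa [heatKernel] using this
    · simp [heatKernel, h]
  | succ n ih =>
    rw [heatKernel_succ]
    exact add_nonneg (mul_nonneg (ih _) (C.pLeft_nonneg x)) (mul_nonneg (ih _) (C.pRight_nonneg x))

/-- The walk is 2-periodic. -/
lemma heatKernel_eq_zero_of_odd (C : Conductances) (n : ℕ) (x : ℤ) (h : Odd (n + x)) :
    C.heatKernel n x = 0 := by
  induction n generalizing x with
  | zero =>
    have : x ≠ 0 := by rintro rfl; simp at h
    simp [heatKernel, this]
  | succ n ih =>
    rw [heatKernel_succ, transitionOp, ih (x - 1) (by push_cast at h; grind),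
      ih (x + 1) (by push_cast at h; grind)]
    simp

lemma innerProd_heatKernel_one (C : Conductances) (n : ℕ) :
    C.innerProd (C.heatKernel n) 1 = 1 := by
  induction n with
  | zero =>
    rw [innerProd, tsum_eq_single 0 fun x hx => by simp [heatKernel, hx]]
    simp [heatKernel, (C.cbar_pos 0).ne']
  | succ n ih =>
    have h1 : C.transitionOp 1 = 1 := by
      ext x
      simp [transitionOp, C.pLeft_add_pRight]
    rw [heatKernel_succ, ← C.innerProd_transitionOp_comm (.inl (C.finite_support_heatKernel n)), h1,
      ih]

lemma innerProd_heatKernel (C : Conductances) (j k : ℕ) :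
    C.innerProd (C.heatKernel j) (C.heatKernel k) = C.heatKernel (j + k) 0 := by
  induction k generalizing j with
  | zero =>
    rw [innerProd, tsum_eq_single 0 fun x hx => by simp [heatKernel, hx]]
    simp [heatKernel, (C.cbar_pos 0).ne']
  | succ k ih =>
    rw [C.heatKernel_succ k, C.innerProd_transitionOp_comm (.inl (C.finite_support_heatKernel j)),
      ← heatKernel_succ, ih, Nat.succ_add_eq_add_succ]

lemma normSq_heatKernel (C : Conductances) (n : ℕ) :
    C.normSq (C.heatKernel n) = C.heatKernel (2 * n) 0 := by
  rw [normSq_eq_innerProd, innerProd_heatKernel, two_mul]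

/-- The decrements of `‖h_n‖²` are nonincreasing, because the second difference at `n` is
`‖h_n - h_{n+2}‖²`. -/
lemma antitone_normSq_heatKernel_sub (C : Conductances) :
    Antitone fun n => C.normSq (C.heatKernel n) - C.normSq (C.heatKernel (n + 1)) := by
  refine antitone_nat_of_succ_le fun n => ?_
  have hf := C.finite_support_heatKernel
  have h := C.normSq_nonneg (C.heatKernel n - C.heatKernel (n + 2))
  have hs : (C.heatKernel n - C.heatKernel (n + 2)).support.Finite :=
    ((hf n).union (hf (n + 2))).subset (Function.support_sub _ _)
  rw [normSq_eq_innerProd, innerProd_sub_right C (.inl hs) (.inl hs), innerProd_comm,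
    innerProd_sub_right C (.inl (hf n)) (.inl (hf n)),
    C.innerProd_comm (C.heatKernel n - C.heatKernel (n + 2)),
    innerProd_sub_right C (.inl (hf _)) (.inl (hf _))] at h
  simp only [innerProd_heatKernel, normSq_heatKernel] at h ⊢
  rw [show n + n = 2 * n by ring, show n + (n + 2) = 2 * (n + 1) by ring,
    show n + 2 + n = 2 * (n + 1) by ring, show n + 2 + (n + 2) = 2 * (n + 1 + 1) by ring] at h
  linarith

/-- By monotonicity, `n` times the decrement at time `2n` is at most the sum of the decrements
between the times `n` and `2n`. -/
lemma mul_normSq_heatKernel_sub_le (C : Conductances) (n : ℕ) :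
    n * (C.normSq (C.heatKernel (2 * n)) - C.normSq (C.heatKernel (2 * n + 1))) ≤
      C.normSq (C.heatKernel n) := by
  set u : ℕ → ℝ := fun k => C.normSq (C.heatKernel k)
  have h : ∑ i ∈ Finset.range n, (u (2 * n) - u (2 * n + 1)) ≤
      ∑ i ∈ Finset.range n, (u (n + i) - u (n + (i + 1))) := by
    refine Finset.sum_le_sum fun i hi => ?_
    have := C.antitone_normSq_heatKernel_sub (show n + i ≤ 2 * n by grind)
    simpa [u, add_assoc] using this
  rw [Finset.sum_range_sub' fun i => u (n + i)] at h
  have h0 : 0 ≤ u (n + n) := C.normSq_nonneg _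
  simp only [Finset.sum_const, Finset.card_range, nsmul_eq_mul, add_zero] at h
  linarith

/-- The Dirichlet energy of `h_{2n} + h_{2n+1}`. Adding the two consecutive kernels compensates the
periodicity of the walk: the energy of `h_{2n}` alone is `‖h_{2n}‖²`, which is not small. -/
lemma tsum_cond_mul_sq_heatKernel_add (C : Conductances) (n : ℕ) :
    ∑' x, C.cond x * ((C.heatKernel (2 * n) + C.heatKernel (2 * n + 1)) (x + 1) -
        (C.heatKernel (2 * n) + C.heatKernel (2 * n + 1)) x) ^ 2 =
      C.normSq (C.heatKernel (2 * n)) - C.normSq (C.heatKernel (2 * n + 1)) := by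
  have hf := C.finite_support_heatKernel
  have hs (k : ℕ) : (C.heatKernel k + C.heatKernel (k + 1)).support.Finite :=
    ((hf k).union (hf (k + 1))).subset (Function.support_add _ _)
  have key (j k : ℕ) : C.innerProd (C.heatKernel j + C.heatKernel (j + 1))
      (C.heatKernel k + C.heatKernel (k + 1)) = C.heatKernel (j + k) 0 +
        2 * C.heatKernel (j + k + 1) 0 + C.heatKernel (j + k + 2) 0 := by
    rw [innerProd_add_right C (.inl (hs j)) (.inl (hs j)), innerProd_comm,
      innerProd_add_right C (.inl (hf _)) (.inl (hf _)), C.innerProd_comm _ (C.heatKernel (k + 1)),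
      innerProd_add_right C (.inl (hf _)) (.inl (hf _))]
    simp only [innerProd_heatKernel]
    rw [show k + j = j + k by ring, show k + (j + 1) = j + k + 1 by ring,
      show k + 1 + j = j + k + 1 by ring, show k + 1 + (j + 1) = j + k + 2 by ring]
    ring
  have hP : C.transitionOp (C.heatKernel (2 * n) + C.heatKernel (2 * n + 1)) =
      C.heatKernel (2 * n + 1) + C.heatKernel (2 * n + 1 + 1) := by
    rw [transitionOp_add, ← heatKernel_succ, ← heatKernel_succ]
  rw [C.tsum_cond_mul_sq (hs _), hP, key, key, normSq_heatKernel, normSq_heatKernel,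
    C.heatKernel_eq_zero_of_odd (2 * n + 2 * n + 1) 0 (by push_cast; grind),
    C.heatKernel_eq_zero_of_odd (2 * n + (2 * n + 1) + 2) 0 (by push_cast; grind),
    show 2 * n + (2 * n + 1) + 1 = 2 * (2 * n + 1) by ring,
    show 2 * n + (2 * n + 1) = 2 * n + 2 * n + 1 by ring,
    C.heatKernel_eq_zero_of_odd (2 * n + 2 * n + 1) 0 (by push_cast; grind),
    show 2 * n + 2 * n + 2 = 2 * (2 * n + 1) by ring,
    show 2 * n + 2 * n = 2 * (2 * n) by ring]
  ring

/-! ### A deterministic bound for the heat kernel -/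

/-- Cauchy-Schwarz along a path whose edges have conductances `w i`: the oscillation of `g` is
controlled by effective resistance times energy. -/
lemma sq_sub_le_sum_inv_mul_sum (g w : ℕ → ℝ) (hw : ∀ i, 0 < w i) {k m : ℕ} (hk : k ≤ m) :
    (g 0 - g k) ^ 2 ≤ (∑ i ∈ Finset.range m, 1 / w i) *
      ∑ i ∈ Finset.range m, w i * (g (i + 1) - g i) ^ 2 := by
  have h1 : (g 0 - g k) ^ 2 ≤ (∑ i ∈ Finset.range k, 1 / w i) *
      ∑ i ∈ Finset.range k, w i * (g (i + 1) - g i) ^ 2 := by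
    rw [← Finset.sum_range_sub']
    refine Finset.sum_sq_le_sum_mul_sum_of_sq_le_mul _ (fun i _ => (one_div_pos.2 (hw i)).le)
      (fun i _ => mul_nonneg (hw i).le (sq_nonneg _)) fun i _ => le_of_eq ?_
    rw [← mul_assoc, one_div_mul_cancel (hw i).ne']
    ring
  have hs : Finset.range k ⊆ Finset.range m := Finset.range_subset_range.2 hk
  refine h1.trans (mul_le_mul ?_ ?_ ?_ ?_)
  · exact Finset.sum_le_sum_of_subset_of_nonneg hs fun i _ _ => (one_div_pos.2 (hw i)).le
  · exact Finset.sum_le_sum_of_subset_of_nonneg hs fun i _ _ => mul_nonneg (hw i).le (sq_nonneg _)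
  · exact Finset.sum_nonneg fun i _ => mul_nonneg (hw i).le (sq_nonneg _)
  · exact Finset.sum_nonneg fun i _ => (one_div_pos.2 (hw i)).le

/-- Among `m` points of total weight at least `W`, the minimum of `f` is at most `(∑ f v) / W`. -/
lemma exists_mul_le_sum_mul (f v : ℕ → ℝ) (hf : ∀ i, 0 ≤ f i) (hv : ∀ i, 0 < v i) {m : ℕ}
    {W : ℝ} (hW0 : 0 < W) (hW : W ≤ ∑ i ∈ Finset.range m, v i) :
    ∃ i < m, f i * W ≤ ∑ i ∈ Finset.range m, f i * v i := by
  have hne : (Finset.range m).Nonempty := by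
    rw [Finset.nonempty_iff_ne_empty]
    intro h
    rw [h, Finset.sum_empty] at hW
    linarith
  obtain ⟨i, hi, hmin⟩ := Finset.exists_min_image (Finset.range m) f hne
  refine ⟨i, Finset.mem_range.1 hi, ?_⟩
  calc f i * W ≤ f i * ∑ j ∈ Finset.range m, v j := mul_le_mul_of_nonneg_left hW (hf i)
    _ = ∑ j ∈ Finset.range m, f i * v j := Finset.mul_sum _ _ _
    _ ≤ _ := Finset.sum_le_sum fun j hj => mul_le_mul_of_nonneg_right (hmin j hj) (hv j).le

lemma sum_range_add_sum_range_neg_le_tsum {F : ℤ → ℝ} (h0 : ∀ x, 0 ≤ F x) (hF : Summable F)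
    (m k : ℕ) : ∑ i ∈ Finset.range m, F i + ∑ i ∈ Finset.range k, F (-(i + 1)) ≤ ∑' x, F x := by
  have h1 : Summable fun i : ℕ => F i := hF.comp_injective Nat.cast_injective
  have h2 : Summable fun i : ℕ => F (-(i + 1)) :=
    hF.comp_injective (i := fun i : ℕ => (-(i + 1) : ℤ)) fun i j h => by simpa using h
  rw [tsum_of_nat_of_neg_add_one h1 h2]
  exact add_le_add (h1.sum_le_tsum _ fun i _ => h0 _) (h2.sum_le_tsum _ fun i _ => h0 _)

/-- A bound for `‖h_n‖²` in terms of a lower bound `W` for the masses, and an upper bound `R` for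
the resistances, of the two intervals of length `m` at either side of the origin. -/
lemma normSq_heatKernel_le (C : Conductances) {n m : ℕ} (hn : 0 < n) {W R : ℝ} (hW0 : 0 < W)
    (hWr : W ≤ ∑ i ∈ Finset.range m, C.cbar (i + 1))
    (hWl : W ≤ ∑ i ∈ Finset.range m, C.cbar (-(i + 1)))
    (hRr : ∑ i ∈ Finset.range m, 1 / C.cond i ≤ R)
    (hRl : ∑ i ∈ Finset.range m, 1 / C.cond (-(i + 1)) ≤ R) :
    C.normSq (C.heatKernel n) ≤ 2 / W + R / (2 * n) := by
  set u := C.normSq (C.heatKernel n) with hu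
  set f : ℤ → ℝ := C.heatKernel (2 * n) + C.heatKernel (2 * n + 1) with hfdef
  have hf0 : ∀ x, 0 ≤ f x := fun x => add_nonneg (C.heatKernel_nonneg _ x) (C.heatKernel_nonneg _ x)
  have hfs : f.support.Finite := ((C.finite_support_heatKernel (2 * n)).union
    (C.finite_support_heatKernel (2 * n + 1))).subset (Function.support_add _ _)
  have hfz : f 0 = u := by
    rw [hfdef, hu, normSq_heatKernel, Pi.add_apply,
      C.heatKernel_eq_zero_of_odd (2 * n + 1) 0 (by push_cast; grind), add_zero]
  have hn' : (0 : ℝ) < n := by exact_mod_cast hn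
  have hmass : ∑' x, f x * C.cbar x = 2 := by
    have h : C.innerProd 1 f = 2 := by
      rw [innerProd_add_right C (.inr (C.finite_support_heatKernel _))
        (.inr (C.finite_support_heatKernel _)), C.innerProd_comm 1, C.innerProd_comm 1,
        innerProd_heatKernel_one, innerProd_heatKernel_one]
      norm_num
    simpa [innerProd] using h
  have hsm : Summable fun x => f x * C.cbar x := by
    simpa using summable_mul_mul (g := 1) (.inl hfs) C.cbar
  set E := ∑' x, C.cond x * (f (x + 1) - f x) ^ 2 with hE
  have hEu : E ≤ u / n := by
    rw [le_div_iff₀' hn', hE, hfdef, tsum_cond_mul_sq_heatKernel_add]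
    exact C.mul_normSq_heatKernel_sub_le n
  obtain ⟨i, him, hi⟩ := exists_mul_le_sum_mul (fun i : ℕ => f (i + 1)) (fun i => C.cbar (i + 1))
    (fun _ => hf0 _) (fun _ => C.cbar_pos _) hW0 hWr
  obtain ⟨j, hjm, hj⟩ := exists_mul_le_sum_mul (fun i : ℕ => f (-(i + 1)))
    (fun i => C.cbar (-(i + 1))) (fun _ => hf0 _) (fun _ => C.cbar_pos _) hW0 hWl
  have hij : (f (i + 1) + f (-(j + 1))) * W ≤ 2 := by
    have h := sum_range_add_sum_range_neg_le_tsum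
      (fun x => mul_nonneg (hf0 x) (C.cbar_pos x).le) hsm (m + 1) m
    rw [hmass, Finset.sum_range_succ'] at h
    have h0 := mul_nonneg (hf0 0) (C.cbar_pos 0).le
    push_cast at h
    linarith
  have hR0 : 0 ≤ R := (Finset.sum_nonneg fun i _ => (one_div_pos.2 (C.pos _)).le).trans hRr
  have hA := sq_sub_le_sum_inv_mul_sum (fun k : ℕ => f k) (fun k => C.cond k) (fun _ => C.pos _)
    (show i + 1 ≤ m from him)
  have hB := sq_sub_le_sum_inv_mul_sum (fun k : ℕ => f (-k)) (fun k => C.cond (-(k + 1)))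
    (fun _ => C.pos _) (show j + 1 ≤ m from hjm)
  have hen := sum_range_add_sum_range_neg_le_tsum
    (fun x => mul_nonneg (C.pos x).le (sq_nonneg (f (x + 1) - f x)))
    (C.summable_cond_mul_sq hfs) m m
  set a := f 0 - f (i + 1) with ha
  set b := f 0 - f (-(j + 1)) with hb
  have hEl : ∑ k ∈ Finset.range m, C.cond (-(k + 1)) * (f (-(k + 1 : ℕ)) - f (-k)) ^ 2 =
      ∑ k ∈ Finset.range m, C.cond (-(k + 1)) * (f (-(k + 1) + 1) - f (-(k + 1))) ^ 2 := by
    refine Finset.sum_congr rfl fun k _ => ?_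
    rw [show (-((k : ℤ) + 1) + 1) = -k by ring]
    push_cast
    ring
  have hab : a ^ 2 + b ^ 2 ≤ R * (u / n) := by
    have hA' := hA.trans (mul_le_mul_of_nonneg_right hRr
      (Finset.sum_nonneg fun k _ => mul_nonneg (C.pos _).le (sq_nonneg _)))
    have hB' := hB.trans (mul_le_mul_of_nonneg_right hRl
      (Finset.sum_nonneg fun k _ => mul_nonneg (C.pos _).le (sq_nonneg _)))
    rw [hEl] at hB'
    push_cast at hA' hB'
    simp only [neg_zero] at hB'
    have := mul_le_mul_of_nonneg_left (hen.trans hEu) hR0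
    rw [mul_add] at this
    exact (add_le_add hA' hB').trans this
  -- The square root of `2 R u / n` is estimated by the arithmetic mean of `2 u` and `R / n`.
  have hu0 : 0 ≤ u := C.normSq_nonneg _
  have hsum : a + b ≤ u + R / (2 * n) := by
    refine le_of_sq_le_sq ?_ (by positivity)
    have e : R * (u / n) = 2 * (u * (R / (2 * n))) := by field_simp
    nlinarith [sq_nonneg (a - b), sq_nonneg (u - R / (2 * n))]
  have hij' : f (i + 1) + f (-(j + 1)) ≤ 2 / W := (le_div_iff₀ hW0).2 hij
  rw [ha, hb, hfz] at hsum
  linarith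

end Conductances

/-! ### The law of the walk -/

namespace Conductances

lemma stepKernel_apply_singleton (C : Conductances) (y x : ℤ) :
    C.stepKernel y {x} = ENNReal.ofReal (C.pLeft y) * (if y = x + 1 then 1 else 0) +
      ENNReal.ofReal (C.pRight y) * (if y = x - 1 then 1 else 0) := by
  change (ENNReal.ofReal (C.pLeft y) • Measure.dirac (y - 1) +
    ENNReal.ofReal (C.pRight y) • Measure.dirac (y + 1)) {x} = _
  simp [Set.indicator, sub_eq_iff_eq_add, eq_sub_iff_add_eq]

/-- The Markov property at time `n`, for the law of `S_{n+1}`. -/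
lemma map_eval_succ_pathLaw (C : Conductances) (x₀ : ℤ) (n : ℕ) :
    (C.pathLaw x₀).map (fun S => S (n + 1)) =
      ((C.pathLaw x₀).map fun S => S n).bind C.stepKernel := by
  have h1 : (C.pathLaw x₀).map (fun S => S (n + 1)) =
      ((C.pathLaw x₀).map (Preorder.frestrictLe n)).bind (C.stepFromPast n) := by
    rw [pathLaw, Kernel.traj_map_frestrictLe_apply,
      ← Kernel.map_traj_succ_self (X := fun _ => ℤ) (κ := C.stepFromPast) (a := n),
      ← Kernel.map_apply _ (by fun_prop), ← Kernel.comp_apply, ← Kernel.map_comp,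
      Kernel.traj_comp_partialTraj (Nat.zero_le n)]
  rw [h1]
  ext s hs
  rw [Measure.bind_apply hs (Kernel.aemeasurable _), Measure.bind_apply hs (Kernel.aemeasurable _),
    lintegral_map (Kernel.measurable_coe _ hs) (by fun_prop),
    lintegral_map (Kernel.measurable_coe _ hs) (by fun_prop)]
  rfl

/-- By reversibility, the law of `S_n` has density `h_n` with respect to `c̄`. -/
lemma map_eval_pathLaw_singleton (C : Conductances) (n : ℕ) (x : ℤ) :
    (C.pathLaw 0).map (fun S => S n) {x} = ENNReal.ofReal (C.heatKernel n x * C.cbar x) := by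
  induction n generalizing x with
  | zero =>
    have h : (C.pathLaw 0).map (fun S => S 0) = Measure.dirac 0 := by
      have e : (fun S : ℕ → ℤ => S 0) = (fun h : Π _ : Finset.Iic 0, ℤ => h ⟨0, by simp⟩) ∘
          Preorder.frestrictLe 0 := rfl
      rw [e, ← Measure.map_map (by fun_prop) (by fun_prop), pathLaw,
        Kernel.traj_map_frestrictLe_apply, Kernel.partialTraj_self, Kernel.id_apply]
      exact Measure.map_dirac' (measurable_pi_apply _) _
    rw [h]
    by_cases hx : x = 0
    · subst hx
      simp [heatKernel, (C.cbar_pos 0).ne']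
    · simp [heatKernel, hx, Ne.symm hx]
  | succ n ih =>
    rw [map_eval_succ_pathLaw, Measure.bind_apply (measurableSet_singleton x)
      (Kernel.aemeasurable _), lintegral_countable']
    simp_rw [ih, stepKernel_apply_singleton, add_mul, mul_assoc]
    rw [ENNReal.tsum_add]
    rw [tsum_eq_single (x + 1) fun y hy => by simp [hy],
      tsum_eq_single (x - 1) fun y hy => by simp [hy]]
    have h0 := C.heatKernel_nonneg n
    simp only [if_true, one_mul]
    rw [← ENNReal.ofReal_mul (C.pLeft_nonneg _), ← ENNReal.ofReal_mul (C.pRight_nonneg _),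
      ← ENNReal.ofReal_add
        (mul_nonneg (C.pLeft_nonneg _) (mul_nonneg (h0 _) (C.cbar_pos _).le))
        (mul_nonneg (C.pRight_nonneg _) (mul_nonneg (h0 _) (C.cbar_pos _).le)),
      heatKernel_succ, transitionOp_mul_cbar]
    congr 1
    have h1 := C.pLeft_mul_cbar (x + 1)
    have h2 := C.pRight_mul_cbar (x - 1)
    rw [add_sub_cancel_right] at h1
    rw [← h1, ← h2]
    ring

lemma normSq_heatKernel_eq_pathLaw_div (C : Conductances) (n : ℕ) :
    C.normSq (C.heatKernel n) = (C.pathLaw 0).real {S | S (2 * n) = 0} / C.cbar 0 := by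
  have h := C.map_eval_pathLaw_singleton (2 * n) 0
  rw [Measure.map_apply (by fun_prop) (measurableSet_singleton 0)] at h
  have e : (fun S : ℕ → ℤ => S (2 * n)) ⁻¹' {0} = {S | S (2 * n) = 0} := rfl
  rw [e] at h
  rw [Measure.real, h, ENNReal.toReal_ofReal
    (mul_nonneg (C.heatKernel_nonneg _ _) (C.cbar_pos 0).le),
    mul_div_cancel_right₀ _ (C.cbar_pos 0).ne', normSq_heatKernel]

end Conductances

/-! ### One-sided ergodic estimates -/

section Ergodic

variable {Ω : Type*}

/-- The running minimum `min (0, S_1, …, S_n)` of the Birkhoff sums `S_k` of `g`, defined through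
the recursion obtained by splitting off the first term of the sums. -/
noncomputable def birkhoffMin (T : Ω → Ω) (g : Ω → ℝ) : ℕ → Ω → ℝ
  | 0 => 0
  | n + 1 => fun ω => min 0 (g ω + birkhoffMin T g n (T ω))

lemma birkhoffMin_nonpos (T : Ω → Ω) (g : Ω → ℝ) (n : ℕ) (ω : Ω) : birkhoffMin T g n ω ≤ 0 := by
  cases n with
  | zero => exact le_rfl
  | succ n => exact min_le_left _ _

lemma birkhoffMin_succ_le (T : Ω → Ω) (g : Ω → ℝ) (n : ℕ) (ω : Ω) :
    birkhoffMin T g (n + 1) ω ≤ birkhoffMin T g n ω := by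
  induction n generalizing ω with
  | zero => exact min_le_left _ _
  | succ n ih => exact min_le_min_left _ (add_le_add_right (ih (T ω)) (g ω))

lemma birkhoffMin_antitone (T : Ω → Ω) (g : Ω → ℝ) (ω : Ω) :
    Antitone fun n => birkhoffMin T g n ω :=
  antitone_nat_of_succ_le fun n => birkhoffMin_succ_le T g n ω

lemma birkhoffMin_le_birkhoffSum (T : Ω → Ω) (g : Ω → ℝ) (n : ℕ) (ω : Ω) :
    birkhoffMin T g n ω ≤ birkhoffSum T g n ω := by
  induction n generalizing ω with
  | zero => exact le_rfl
  | succ n ih =>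
    rw [birkhoffSum_succ']
    exact (min_le_right _ _).trans (add_le_add_right (ih (T ω)) _)

lemma birkhoffSum_sub_const (T : Ω → Ω) (g : Ω → ℝ) (a : ℝ) (n : ℕ) (ω : Ω) :
    birkhoffSum T (fun ω => g ω - a) n ω = birkhoffSum T g n ω - n * a := by
  simp [birkhoffSum, Finset.sum_sub_distrib]

variable [MeasurableSpace Ω] {μ : Measure Ω} {T : Ω → Ω} {g : Ω → ℝ}

lemma measurable_birkhoffMin (hT : Measurable T) (hg : Measurable g) (n : ℕ) :
    Measurable (birkhoffMin T g n) := by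
  induction n with
  | zero => exact measurable_const
  | succ n ih => exact measurable_const.min (hg.add (ih.comp hT))

lemma integrable_birkhoffMin (hT : MeasurePreserving T μ μ) (hg : Integrable g μ) (n : ℕ) :
    Integrable (birkhoffMin T g n) μ := by
  induction n with
  | zero => exact integrable_zero _ _ _
  | succ n ih => exact (integrable_zero _ _ _).inf (hg.add (hT.integrable_comp_of_integrable ih))

/-- If `∫ g > 0` then the Birkhoff sums of `g` are almost surely bounded below. Otherwise, by
ergodicity, their running minima `F_n` tend to `-∞` almost surely, and then
`F_{n+1} - F_n ∘ T = min (-F_n ∘ T, g)` converges to `g`, whereas its integral is that of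
`F_{n+1} - F_n ≤ 0`. -/
lemma Ergodic.ae_exists_le_birkhoffSum (hT : Ergodic T μ) (hgm : Measurable g)
    (hg : Integrable g μ) (hpos : 0 < ∫ ω, g ω ∂μ) :
    ∀ᵐ ω ∂μ, ∃ B : ℝ, ∀ n, B ≤ birkhoffSum T g n ω := by
  let F := birkhoffMin T g
  have hFS : ∀ n ω, F (n + 1) ω = min 0 (g ω + F n (T ω)) := fun _ _ => rfl
  set A : Set Ω := {ω | ∃ k : ℕ, ∀ n, -(k : ℝ) ≤ F n ω} with hA
  have hAm : MeasurableSet A := by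
    have e : A = ⋃ k : ℕ, ⋂ n, {ω | -(k : ℝ) ≤ F n ω} := by
      ext ω; simp [hA]
    rw [e]
    exact .iUnion fun k => .iInter fun n =>
      measurableSet_le measurable_const (measurable_birkhoffMin hT.measurable hgm n)
  have hinv : T ⁻¹' A = A := by
    ext ω
    constructor
    · rintro ⟨k, hk⟩
      obtain ⟨j, hj⟩ := exists_nat_ge (k - g ω)
      refine ⟨j, fun n => ?_⟩
      cases n with
      | zero => simp [F, birkhoffMin]
      | succ n =>
        rw [hFS]
        exact le_min (by simp) (by linarith [hk n])
    · rintro ⟨k, hk⟩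
      obtain ⟨j, hj⟩ := exists_nat_ge (k + g ω)
      refine ⟨j, fun n => ?_⟩
      have := (hk (n + 1)).trans (min_le_right _ _)
      linarith
  rcases hT.ae_mem_or_ae_notMem hAm hinv with h | h
  · filter_upwards [h] with ω ⟨k, hk⟩
    exact ⟨-k, fun n => (hk n).trans (birkhoffMin_le_birkhoffSum T g n ω)⟩
  · exfalso
    have hFi : ∀ n, Integrable (F n) μ := integrable_birkhoffMin hT.toMeasurePreserving hg
    have hFTi : ∀ n, Integrable (fun ω => F n (T ω)) μ := fun n =>
      hT.toMeasurePreserving.integrable_comp_of_integrable (hFi n)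
    have hlim : Tendsto (fun n => ∫ ω, (F (n + 1) ω - F n (T ω)) ∂μ) atTop
        (nhds (∫ ω, g ω ∂μ)) := by
      refine tendsto_integral_of_dominated_convergence (fun ω => |g ω|)
        (fun n => ((hFi (n + 1)).sub (hFTi n)).aestronglyMeasurable)
        hg.abs (fun n => Eventually.of_forall fun ω => ?_) ?_
      · have h0 : F n (T ω) ≤ 0 := birkhoffMin_nonpos T g n (T ω)
        rw [hFS, Real.norm_eq_abs, abs_le]
        have := neg_abs_le (g ω)
        have := le_abs_self (g ω)
        have := abs_nonneg (g ω)
        constructor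
        · have : -|g ω| + F n (T ω) ≤ min 0 (g ω + F n (T ω)) :=
            le_min (by linarith) (by linarith)
          linarith
        · have := min_le_right 0 (g ω + F n (T ω))
          linarith
      · filter_upwards [h] with ω hω
        have hω' : T ω ∉ A := fun hc => hω (hinv ▸ hc)
        obtain ⟨k, hk⟩ := exists_nat_ge (g ω)
        have : ∃ n, F n (T ω) < -(k : ℝ) := by
          by_contra! hc
          exact hω' ⟨k, hc⟩
        obtain ⟨N, hN⟩ := this
        refine tendsto_const_nhds.congr' ?_
        filter_upwards [eventually_ge_atTop N] with n hn
        have : F n (T ω) ≤ F N (T ω) := birkhoffMin_antitone T g (T ω) hn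
        rw [hFS, min_eq_right (by linarith)]
        ring
    have hle : ∀ n, ∫ ω, (F (n + 1) ω - F n (T ω)) ∂μ ≤ 0 := fun n => by
      have e : ∫ ω, F n (T ω) ∂μ = ∫ ω, F n ω ∂μ := by
        conv_rhs => rw [← hT.toMeasurePreserving.map_eq]
        refine (integral_map hT.measurable.aemeasurable ?_).symm
        exact (measurable_birkhoffMin hT.measurable hgm n).aestronglyMeasurable
      rw [integral_sub (hFi _) (hFTi n), e]
      exact sub_nonpos.2 (integral_mono (hFi _) (hFi _) (birkhoffMin_succ_le T g n))
    exact absurd (le_of_tendsto' hlim hle) (not_le.2 hpos)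

variable [IsProbabilityMeasure μ]

lemma Ergodic.ae_eventually_mul_le_birkhoffSum (hT : Ergodic T μ) (hgm : Measurable g)
    (hg : Integrable g μ) {a : ℝ} (ha : a < ∫ ω, g ω ∂μ) :
    ∀ᵐ ω ∂μ, ∀ᶠ n : ℕ in atTop, n * a ≤ birkhoffSum T g n ω := by
  obtain ⟨b, hab, hb⟩ := exists_between ha
  have hi : Integrable (fun ω => g ω - b) μ := hg.sub (integrable_const b)
  have hpos : 0 < ∫ ω, (g ω - b) ∂μ := by
    rw [integral_sub hg (integrable_const b)]
    simpa using hb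
  filter_upwards [hT.ae_exists_le_birkhoffSum (hgm.sub_const b) hi hpos] with ω ⟨B, hB⟩
  obtain ⟨N, hN⟩ := exists_nat_ge (-B / (b - a))
  filter_upwards [eventually_ge_atTop N] with n hn
  have h1 := hB n
  rw [birkhoffSum_sub_const] at h1
  have h2 : -B / (b - a) ≤ n := hN.trans (by exact_mod_cast hn)
  rw [div_le_iff₀ (by linarith)] at h2
  linarith

lemma Ergodic.ae_eventually_birkhoffSum_le_mul (hT : Ergodic T μ) (hgm : Measurable g)
    (hg : Integrable g μ) {a : ℝ} (ha : ∫ ω, g ω ∂μ < a) :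
    ∀ᵐ ω ∂μ, ∀ᶠ n : ℕ in atTop, birkhoffSum T g n ω ≤ n * a := by
  have h := hT.ae_eventually_mul_le_birkhoffSum hgm.neg hg.neg (a := -a)
    (by simpa [integral_neg] using ha)
  filter_upwards [h] with ω hω
  filter_upwards [hω] with n hn
  have e : birkhoffSum T (-g) n ω = -birkhoffSum T g n ω := by simp [birkhoffSum]
  rw [e] at hn
  linarith

/-- The lower estimate also holds for nonnegative functions of possibly infinite integral, by
truncation. -/
lemma Ergodic.ae_eventually_mul_le_birkhoffSum_of_lintegral (hT : Ergodic T μ)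
    (hgm : Measurable g) (hg0 : ∀ ω, 0 ≤ g ω) {a : ℝ}
    (ha : ENNReal.ofReal a < ∫⁻ ω, ENNReal.ofReal (g ω) ∂μ) :
    ∀ᵐ ω ∂μ, ∀ᶠ n : ℕ in atTop, n * a ≤ birkhoffSum T g n ω := by
  have hlim : Tendsto (fun N : ℕ => ∫⁻ ω, ENNReal.ofReal (min (g ω) N) ∂μ) atTop
      (nhds (∫⁻ ω, ENNReal.ofReal (g ω) ∂μ)) := by
    refine lintegral_tendsto_of_tendsto_of_monotone
      (fun N => ((hgm.min measurable_const).ennreal_ofReal).aemeasurable)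
      (Eventually.of_forall fun ω => fun N M hNM =>
        ENNReal.ofReal_le_ofReal (min_le_min_left _ (by exact_mod_cast hNM)))
      (Eventually.of_forall fun ω => ?_)
    obtain ⟨K, hK⟩ := exists_nat_ge (g ω)
    refine tendsto_const_nhds.congr' ?_
    filter_upwards [eventually_ge_atTop K] with N hN
    rw [min_eq_left (hK.trans (by exact_mod_cast hN))]
  obtain ⟨N, hN⟩ := (hlim.eventually_const_lt ha).exists
  have h0 : ∀ ω, 0 ≤ min (g ω) N := fun ω => le_min (hg0 ω) (Nat.cast_nonneg N)
  have hmm : Measurable fun ω => min (g ω) (N : ℝ) := hgm.min measurable_const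
  have hi : Integrable (fun ω => min (g ω) (N : ℝ)) μ := by
    refine Integrable.of_bound hmm.aestronglyMeasurable N (Eventually.of_forall fun ω => ?_)
    rw [Real.norm_eq_abs, abs_of_nonneg (h0 ω)]
    exact min_le_right _ _
  rw [← ofReal_integral_eq_lintegral_ofReal hi (Eventually.of_forall h0)] at hN
  filter_upwards [hT.ae_eventually_mul_le_birkhoffSum hmm hi (ENNReal.ofReal_lt_ofReal_iff'.1 hN).1]
    with ω hω
  filter_upwards [hω] with n hn
  exact hn.trans (Finset.sum_le_sum fun k _ => min_le_left _ _)

end Ergodic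

/-! ### From ergodic averages to the decay of the heat kernel -/

/-- If the masses and the resistances of the intervals at either side of the origin grow linearly,
with rates at least `B` and at most `R`, then the deterministic bound gives the decay of `‖h_n‖²`
when applied to intervals of length `m ∼ τ √n`. -/
lemma Conductances.limsup_sqrt_mul_normSq_heatKernel_le (C : Conductances) {B R : ℝ} (hB : 0 < B)
    (hR : 0 < R)
    (hWr : ∀ᶠ m : ℕ in atTop, m * B ≤ ∑ i ∈ Finset.range m, C.cbar (i + 1))
    (hWl : ∀ᶠ m : ℕ in atTop, m * B ≤ ∑ i ∈ Finset.range m, C.cbar (-(i + 1)))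
    (hRr : ∀ᶠ m : ℕ in atTop, ∑ i ∈ Finset.range m, 1 / C.cond i ≤ m * R)
    (hRl : ∀ᶠ m : ℕ in atTop, ∑ i ∈ Finset.range m, 1 / C.cond (-(i + 1)) ≤ m * R) :
    limsup (fun n : ℕ => ENNReal.ofReal (√n * C.normSq (C.heatKernel n))) atTop ≤
      ENNReal.ofReal (2 * √(R / B)) := by
  -- The value of `τ` that minimizes the limiting bound `2 / (τ B) + τ R / 2`.
  set τ : ℝ := 2 / √(R * B) with hτ
  have hs : 0 < √(R * B) := Real.sqrt_pos.2 (mul_pos hR hB)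
  have hτ0 : 0 < τ := div_pos two_pos hs
  have hsqrt : Tendsto (fun n : ℕ => √(n : ℝ)) atTop atTop :=
    Real.tendsto_sqrt_atTop.comp tendsto_natCast_atTop_atTop
  have hm : Tendsto (fun n : ℕ => ⌊τ * √(n : ℝ)⌋₊) atTop atTop :=
    tendsto_nat_floor_atTop.comp (hsqrt.const_mul_atTop hτ0)
  have hratio : Tendsto (fun n : ℕ => (⌊τ * √(n : ℝ)⌋₊ : ℝ) / √n) atTop (nhds τ) :=
    (tendsto_nat_floor_mul_div_atTop hτ0.le).comp hsqrt
  have hlim : Tendsto (fun n : ℕ => 2 / ((⌊τ * √(n : ℝ)⌋₊ : ℝ) / √n * B) +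
      (⌊τ * √(n : ℝ)⌋₊ : ℝ) / √n * R / 2) atTop (nhds (2 / (τ * B) + τ * R / 2)) :=
    (tendsto_const_nhds.div (hratio.mul_const B) (by positivity)).add
      ((hratio.mul_const R).div_const 2)
  have hval : 2 / (τ * B) + τ * R / 2 = 2 * √(R / B) := by
    have e : √(R / B) = R / √(R * B) := by
      rw [Real.sqrt_eq_iff_mul_self_eq_of_pos (div_pos hR hs), div_mul_div_comm,
        Real.mul_self_sqrt (mul_pos hR hB).le, mul_div_mul_left _ _ hR.ne']
    have e2 : √(R * B) ^ 2 = R * B := Real.sq_sqrt (mul_pos hR hB).le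
    rw [e, hτ]
    field_simp
    rw [e2]
    ring
  rw [hval] at hlim
  rw [← (ENNReal.tendsto_ofReal hlim).limsup_eq]
  refine limsup_le_limsup ?_
  filter_upwards [hm.eventually hWr, hm.eventually hWl, hm.eventually hRr, hm.eventually hRl,
    hm.eventually_gt_atTop 0, eventually_gt_atTop 0] with n h1 h2 h3 h4 hm0 hn
  refine ENNReal.ofReal_le_ofReal ?_
  have hm0' : (0 : ℝ) < ⌊τ * √(n : ℝ)⌋₊ := by exact_mod_cast hm0
  have hn' : 0 < √(n : ℝ) := Real.sqrt_pos.2 (by exact_mod_cast hn)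
  have h := C.normSq_heatKernel_le hn (mul_pos hm0' hB) h1 h2 h3 h4
  refine (mul_le_mul_of_nonneg_left h hn'.le).trans_eq ?_
  rw [show (n : ℝ) = √n ^ 2 from (Real.sq_sqrt (Nat.cast_nonneg n)).symm]
  rw [Real.sqrt_sq hn'.le]
  field_simp

section Environment

variable {Ω : Type*} [MeasurableSpace Ω] (T : Ω ≃ᵐ Ω) (c : Ω → ℝ) (hpos : ∀ ω, 0 < c ω)

lemma environment_cond_natCast (ω : Ω) (i : ℕ) :
    (environment T c hpos ω).cond i = c (T^[i] ω) := by
  change c (((T.toEquiv : Equiv.Perm Ω) ^ (i : ℤ)) ω) = _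
  rw [zpow_natCast, ← Equiv.Perm.iterate_eq_pow]
  rfl

lemma environment_cond_neg_natCast (ω : Ω) (i : ℕ) :
    (environment T c hpos ω).cond (-i) = c (T.symm^[i] ω) := by
  change c (((T.toEquiv : Equiv.Perm Ω) ^ (-(i : ℤ))) ω) = _
  rw [zpow_neg, zpow_natCast, ← inv_pow, ← Equiv.Perm.iterate_eq_pow]
  rfl

lemma environment_cbar_zero (ω : Ω) :
    (environment T c hpos ω).cbar 0 = c (T.symm ω) + c ω := by
  have h0 := environment_cond_natCast T c hpos ω 0
  have h1 := environment_cond_neg_natCast T c hpos ω 1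
  simp only [Nat.cast_zero, Nat.cast_one, Function.iterate_zero, Function.iterate_one, id] at h0 h1
  rw [Conductances.cbar, zero_sub, h0, h1]

lemma environment_cbar_add_one (ω : Ω) (i : ℕ) :
    (environment T c hpos ω).cbar (i + 1) = (environment T c hpos (T (T^[i] ω))).cbar 0 := by
  have h := environment_cond_natCast T c hpos ω (i + 1)
  rw [Function.iterate_succ_apply'] at h
  push_cast at h
  rw [environment_cbar_zero, Conductances.cbar, add_sub_cancel_right, h, environment_cond_natCast,
    T.symm_apply_apply]

lemma environment_cbar_neg_add_one (ω : Ω) (i : ℕ) :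
    (environment T c hpos ω).cbar (-(i + 1)) =
      (environment T c hpos (T.symm (T.symm^[i] ω))).cbar 0 := by
  have h1 := environment_cond_neg_natCast T c hpos ω (i + 1)
  have h2 := environment_cond_neg_natCast T c hpos ω (i + 1 + 1)
  rw [Function.iterate_succ_apply', Function.iterate_succ_apply'] at h2
  rw [Function.iterate_succ_apply'] at h1
  push_cast at h1 h2
  rw [environment_cbar_zero, Conductances.cbar, h1, ← h2]
  congr 2

variable {T c}

lemma measurable_environment_cbar_zero (hc : Measurable c) :
    Measurable fun ω => (environment T c hpos ω).cbar 0 := by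
  simp_rw [environment_cbar_zero]
  exact (hc.comp T.symm.measurable).add hc

variable {μ : Measure Ω} [IsProbabilityMeasure μ]

lemma ae_limsup_sqrt_mul_normSq_heatKernel_le (hT : Ergodic T μ) (hc : Measurable c)
    (hint : Integrable (fun ω => 1 / c ω) μ) {B R : ℝ} (hB : 0 < B) (hR : 0 < R)
    (hB' : ENNReal.ofReal B < ∫⁻ ω, ENNReal.ofReal ((environment T c hpos ω).cbar 0) ∂μ)
    (hR' : ∫ ω, 1 / c ω ∂μ < R) :
    ∀ᵐ ω ∂μ, limsup (fun n : ℕ => ENNReal.ofReal (√n *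
        (environment T c hpos ω).normSq ((environment T c hpos ω).heatKernel n))) atTop ≤
      ENNReal.ofReal (2 * √(R / B)) := by
  have hcb := measurable_environment_cbar_zero (T := T) hpos hc
  have hc1 : Measurable fun ω => 1 / c ω := hc.const_div 1
  have hcb0 : ∀ ω, 0 ≤ (environment T c hpos ω).cbar 0 := fun ω => (Conductances.cbar_pos _ 0).le
  have hS : Ergodic T.symm μ := hT.symm
  have hintS : Integrable (fun ω => 1 / c (T.symm ω)) μ :=
    hS.toMeasurePreserving.integrable_comp_of_integrable hint
  have hr : ∫ ω, 1 / c (T.symm ω) ∂μ = ∫ ω, 1 / c ω ∂μ :=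
    hS.toMeasurePreserving.integral_comp T.symm.measurableEmbedding fun ω => 1 / c ω
  filter_upwards [
    hT.ae_eventually_mul_le_birkhoffSum_of_lintegral (hcb.comp T.measurable) (fun _ => hcb0 _)
      (hB'.trans_eq (hT.toMeasurePreserving.lintegral_comp hcb.ennreal_ofReal).symm),
    hS.ae_eventually_mul_le_birkhoffSum_of_lintegral (hcb.comp T.symm.measurable) (fun _ => hcb0 _)
      (hB'.trans_eq (hS.toMeasurePreserving.lintegral_comp hcb.ennreal_ofReal).symm),
    hT.ae_eventually_birkhoffSum_le_mul hc1 hint hR',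
    hS.ae_eventually_birkhoffSum_le_mul (hc1.comp T.symm.measurable) hintS (hr.trans_lt hR')]
    with ω h1 h2 h3 h4
  refine Conductances.limsup_sqrt_mul_normSq_heatKernel_le _ hB hR ?_ ?_ ?_ ?_
  · simp_rw [environment_cbar_add_one]
    exact h1
  · simp_rw [environment_cbar_neg_add_one]
    exact h2
  · simp_rw [environment_cond_natCast]
    exact h3
  · have e (i : ℕ) : (environment T c hpos ω).cond (-(i + 1)) = c (T.symm (T.symm^[i] ω)) := by
      rw [← Function.iterate_succ_apply' T.symm, ← environment_cond_neg_natCast T c hpos]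
      push_cast
      rfl
    simp_rw [e]
    exact h4

lemma integral_one_div_pos (hint : Integrable (fun ω => 1 / c ω) μ) (hpos : ∀ ω, 0 < c ω) :
    0 < ∫ ω, 1 / c ω ∂μ := by
  rw [integral_pos_iff_support_of_nonneg (fun ω => (one_div_pos.2 (hpos ω)).le) hint]
  have e : Function.support (fun ω => 1 / c ω) = Set.univ :=
    Set.eq_univ_of_forall fun ω => (one_div_pos.2 (hpos ω)).ne'
  rw [e]
  simp

/-- When `c̄` is not integrable, its ergodic averages exceed every `B`. -/
lemma ae_limsup_sqrt_mul_normSq_heatKernel_eq_zero (hT : Ergodic T μ) (hc : Measurable c)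
    (hint : Integrable (fun ω => 1 / c ω) μ)
    (htop : ∫⁻ ω, ENNReal.ofReal ((environment T c hpos ω).cbar 0) ∂μ = ∞) :
    ∀ᵐ ω ∂μ, limsup (fun n : ℕ => ENNReal.ofReal (√n *
        (environment T c hpos ω).normSq ((environment T c hpos ω).heatKernel n))) atTop = 0 := by
  set R := ∫ ω, 1 / c ω ∂μ + 1 with hRdef
  have hR : 0 < R := by linarith [integral_one_div_pos hint hpos]
  have h : ∀ k : ℕ, ∀ᵐ ω ∂μ, limsup (fun n : ℕ => ENNReal.ofReal (√n *
      (environment T c hpos ω).normSq ((environment T c hpos ω).heatKernel n))) atTop ≤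
      ENNReal.ofReal (2 * √(R / ((k : ℝ) + 1))) := fun k =>
    ae_limsup_sqrt_mul_normSq_heatKernel_le hpos hT hc hint (by positivity) hR
      (htop ▸ ENNReal.ofReal_lt_top) (by linarith)
  filter_upwards [ae_all_iff.2 h] with ω hω
  have hlim : Tendsto (fun k : ℕ => ENNReal.ofReal (2 * √(R / ((k : ℝ) + 1)))) atTop (nhds 0) := by
    have h1 : Tendsto (fun k : ℕ => R / ((k : ℝ) + 1)) atTop (nhds 0) :=
      tendsto_const_nhds.div_atTop (tendsto_atTop_add_const_right _ 1 tendsto_natCast_atTop_atTop)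
    simpa using ENNReal.tendsto_ofReal ((h1.sqrt).const_mul 2)
  exact nonpos_iff_eq_zero.1 (ge_of_tendsto' hlim hω)

end Environment

theorem mainTheorem4 {Ω : Type*} [MeasurableSpace Ω] (μ : Measure Ω) [IsProbabilityMeasure μ]
    (T : Ω ≃ᵐ Ω) (hT : Ergodic T μ) (c : Ω → ℝ) (hc : Measurable c) (hpos : ∀ ω, 0 < c ω)
    (hint : Integrable (fun ω => 1 / c ω) μ) :
    (∀ (ω : Ω) (n : ℕ),
      (environment T c hpos ω).normSq ((environment T c hpos ω).heatKernel n) =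
        ((environment T c hpos ω).pathLaw 0).real {S | S (2 * n) = 0} /
          (environment T c hpos ω).cbar 0) ∧
    (∀ᵐ ω ∂μ,
      limsup (fun n : ℕ => ENNReal.ofReal (√n *
          (environment T c hpos ω).normSq ((environment T c hpos ω).heatKernel n))) atTop ≤
        3 * ((∫⁻ ω', ENNReal.ofReal (1 / c ω') ∂μ) /
          (∫⁻ ω', ENNReal.ofReal ((environment T c hpos ω').cbar 0) ∂μ)) ^ (1 / 2 : ℝ)) ∧
    ((∫⁻ ω', ENNReal.ofReal ((environment T c hpos ω').cbar 0) ∂μ) = ∞ →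
      ∀ᵐ ω ∂μ,
        Tendsto (fun n : ℕ => √n *
          (environment T c hpos ω).normSq ((environment T c hpos ω).heatKernel n))
          atTop (nhds 0)) := by
  refine ⟨fun ω n => Conductances.normSq_heatKernel_eq_pathLaw_div _ n, ?_, fun htop => ?_⟩
  · set b := ∫⁻ ω', ENNReal.ofReal ((environment T c hpos ω').cbar 0) ∂μ with hb
    by_cases htop : b = ∞
    · filter_upwards [ae_limsup_sqrt_mul_normSq_heatKernel_eq_zero hpos hT hc hint htop] with ω hω
      rw [hω]
      exact zero_le
    have hρ := integral_one_div_pos hint hpos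
    rw [← ofReal_integral_eq_lintegral_ofReal hint
      (Eventually.of_forall fun ω => (one_div_pos.2 (hpos ω)).le)]
    set ρ := ∫ ω, 1 / c ω ∂μ
    have hb0 : b ≠ 0 := by
      rw [hb, ← pos_iff_ne_zero, lintegral_pos_iff_support
        (measurable_environment_cbar_zero hpos hc).ennreal_ofReal]
      have e : Function.support (fun ω => ENNReal.ofReal ((environment T c hpos ω).cbar 0)) =
          Set.univ := Set.eq_univ_of_forall fun ω =>
        (ENNReal.ofReal_pos.2 (Conductances.cbar_pos _ 0)).ne'
      simp [e]
    set β := b.toReal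
    have hβ : 0 < β := ENNReal.toReal_pos hb0 htop
    have hbβ : b = ENNReal.ofReal β := (ENNReal.ofReal_toReal htop).symm
    -- Rates off by a factor `3 / 2` turn the constant `2` into `3`.
    have h := ae_limsup_sqrt_mul_normSq_heatKernel_le hpos hT hc hint (B := 2 * β / 3)
      (R := 3 * ρ / 2) (by positivity) (by positivity)
      (by rw [← hb, hbβ, ENNReal.ofReal_lt_ofReal_iff hβ]; linarith)
      (show ρ < 3 * ρ / 2 by linarith)
    have e : ENNReal.ofReal (2 * √(3 * ρ / 2 / (2 * β / 3))) =
        3 * (ENNReal.ofReal ρ / b) ^ (1 / 2 : ℝ) := by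
      have e1 : 3 * ρ / 2 / (2 * β / 3) = (3 / 2) ^ 2 * (ρ / β) := by
        field_simp
      rw [e1, Real.sqrt_mul (by positivity), Real.sqrt_sq (by norm_num), ← mul_assoc,
        show (2 : ℝ) * (3 / 2) = 3 by norm_num, ENNReal.ofReal_mul (by norm_num), hbβ,
        ← ENNReal.ofReal_div_of_pos hβ, ENNReal.ofReal_rpow_of_nonneg (by positivity) (by norm_num),
        Real.sqrt_eq_rpow]
      simp
    rwa [e] at h
  · filter_upwards [ae_limsup_sqrt_mul_normSq_heatKernel_eq_zero hpos hT hc hint htop] with ω hω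
    have h := tendsto_of_le_liminf_of_limsup_le (zero_le (a := liminf _ atTop)) hω.le
    have h' := (ENNReal.tendsto_toReal ENNReal.zero_ne_top).comp h
    refine (ENNReal.toReal_zero ▸ h').congr fun n => ?_
    exact ENNReal.toReal_ofReal (mul_nonneg (Real.sqrt_nonneg _) (Conductances.normSq_nonneg _ _))
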